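/- Let $\mathbb{K}$ be a field and let $Q$ be a finite quiver having at least one edge that does not lie on a directed cycle, i.e. an edge $v\to w$ such that there is no directed path from $w$ to $v$ (equivalently, an edge between two distinct strongly connected components). Let $\mathbf{Reach}_Q$ be the category whose objects are the vertices of $Q$, with exactly one morphism $v\to w$ if there is a (possibly trivial) directed path from $v$ to $w$ in $Q$, and none otherwise. Let $\mathcal{R}(Q)$ be the poset of vertices of $Q$ modulo mutual reachability, with $[v]\le[w]$ if and only if there is a directed path from $v$ to $w$; regard it also as a category. For a category $\mathbf{C}$ with finitely many objects, let $\mathbb{K}\mathbf{C}$ denote its category algebra: the $\mathbb{K}$-vector space with basis the morphisms of $\mathbf{C}$, with $f\cdot g=f\circ g$ if the composition exists and $f\cdot g=0$ otherwise. The global dimension $\mathrm{gl.dim}\,R$ of a ring $R$ is the supremum of the projective dimensions of all (left) $R$-modules. Let $\mathbf{B}_{1,1}$ be the poset $\{x,v,w,y\}$ generated by the directed square $x\to v\to y$, $x\to w\to y$ (so $v$ and $w$ are incomparable). Then \[ \mathrm{gl.dim}\,\mathbb{K}\mathbf{Reach}_Q=\mathrm{gl.dim}\,\mathbb{K}\mathcal{R}(Q),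 \] and this common value equals $1$ if and only if $\mathcal{R}(Q)$ does not contain $\mathbf{B}_{1,1}$ as a subposet, i.e. if and only if no four-element subset of $\mathcal{R}(Q)$ with the induced order is isomorphic to $\mathbf{B}_{1,1}$. -/

import Mathlib

open CategoryTheory

noncomputable section

universe w u v v₁ u₁

/-! ### Category algebras -/

/-- The category algebra `R C`: the free `R`-module on the set of all morphisms of `C`. -/
def CategoryAlgebra (R : Type u) (C : Type u₁) [CommRing R] [Category.{v₁} C] :
    Type (max u u₁ v₁) :=
  (Σ X Y : C, X ⟶ Y) →₀ R

namespace CategoryAlgebra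

variable (R : Type u) (C : Type u₁) [CommRing R] [Category.{v₁} C]

instance : AddCommGroup (CategoryAlgebra R C) :=
  inferInstanceAs (AddCommGroup ((Σ X Y : C, X ⟶ Y) →₀ R))

instance : Module R (CategoryAlgebra R C) :=
  inferInstanceAs (Module R ((Σ X Y : C, X ⟶ Y) →₀ R))

variable {C}

/-- The basis element of the category algebra given by a morphism `f`. -/
def of {X Y : C} (f : X ⟶ Y) : CategoryAlgebra R C :=
  Finsupp.single (⟨X, Y, f⟩ : Σ X Y : C, X ⟶ Y) (1 : R)

open Classical in
/-- The product of two basis elements: `f · g = f ∘ g` (in Mathlib's notation `g ≫ f`) if the target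
of `g` is the source of `f`, and `0` otherwise. -/
def basisMul (f g : Σ X Y : C, X ⟶ Y) : CategoryAlgebra R C :=
  if h : g.2.1 = f.1 then of R (g.2.2 ≫ eqToHom h ≫ f.2.2) else 0

/-- The linear map on the category algebra with given values on the basis. -/
def lift {M : Type*} [AddCommMonoid M] [Module R M] (φ : (Σ X Y : C, X ⟶ Y) → M) :
    CategoryAlgebra R C →ₗ[R] M :=
  Finsupp.lift M R (Σ X Y : C, X ⟶ Y) φ

theorem lift_of {M : Type*} [AddCommMonoid M] [Module R M] (φ : (Σ X Y : C, X ⟶ Y) → M)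
    {X Y : C} (f : X ⟶ Y) : lift R φ (of R f) = φ ⟨X, Y, f⟩ := by
  have h := Finsupp.sum_single_index (a := (⟨X, Y, f⟩ : Σ X Y : C, X ⟶ Y)) (b := (1 : R))
    (h := fun x r => r • φ x) (zero_smul R _)
  exact h.trans (one_smul R _)

variable (C)

/-- The product of the category algebra, as the bilinear extension of `basisMul`. -/
def mulHom : CategoryAlgebra R C →ₗ[R] CategoryAlgebra R C →ₗ[R] CategoryAlgebra R C :=
  lift R fun f => lift R fun g => basisMul R f g

instance : Mul (CategoryAlgebra R C) := ⟨fun a b => mulHom R C a b⟩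

/-- The sum of the identities of all objects (for finitely many objects). -/
instance [Finite C] : One (CategoryAlgebra R C) := ⟨∑ᶠ X : C, of R (𝟙 X)⟩

variable {R C}

theorem mul_def (a b : CategoryAlgebra R C) : a * b = mulHom R C a b := rfl

theorem one_def [Finite C] : (1 : CategoryAlgebra R C) = ∑ᶠ X : C, of R (𝟙 X) := rfl

theorem of_mul_of_eq_basisMul {X Y X' Y' : C} (f : X ⟶ Y) (g : X' ⟶ Y') :
    of R f * of R g = basisMul R ⟨X, Y, f⟩ ⟨X', Y', g⟩ := by
  rw [mul_def, mulHom, lift_of, lift_of]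

theorem of_mul_of {X Y Z : C} (f : Y ⟶ Z) (g : X ⟶ Y) : of R f * of R g = of R (g ≫ f) := by
  simp [of_mul_of_eq_basisMul, basisMul]

theorem of_mul_of_ne {X Y X' Y' : C} (f : X ⟶ Y) (g : X' ⟶ Y') (h : Y' ≠ X) :
    of R f * of R g = 0 := by
  simp [of_mul_of_eq_basisMul, basisMul, h]

protected theorem add_mul' (a b c : CategoryAlgebra R C) : (a + b) * c = a * c + b * c := by
  simp [mul_def]

protected theorem mul_add' (a b c : CategoryAlgebra R C) : a * (b + c) = a * b + a * c := by
  simp [mul_def]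

protected theorem smul_mul' (r : R) (a b : CategoryAlgebra R C) : (r • a) * b = r • (a * b) := by
  simp [mul_def]

protected theorem mul_smul' (r : R) (a b : CategoryAlgebra R C) : a * (r • b) = r • (a * b) := by
  simp [mul_def]

protected theorem zero_mul' (a : CategoryAlgebra R C) : 0 * a = 0 := by
  simp [mul_def]

protected theorem mul_zero' (a : CategoryAlgebra R C) : a * 0 = 0 := by
  simp [mul_def]

@[elab_as_elim]
theorem induction_on {p : CategoryAlgebra R C → Prop} (a : CategoryAlgebra R C) (zero : p 0)
    (add : ∀ a b, p a → p b → p (a + b))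
    (smul_of : ∀ (r : R) (X Y : C) (f : X ⟶ Y), p (r • of R f)) : p a := by
  refine Finsupp.induction_linear (motive := p) a zero add ?_
  rintro ⟨X, Y, f⟩ r
  have h := smul_of r X Y f
  have e : r • of R f = (Finsupp.single (⟨X, Y, f⟩ : Σ X Y : C, X ⟶ Y) r) :=
    (Finsupp.smul_single r _ _).trans (by simp)
  rwa [e] at h

protected theorem mul_assoc' (a b c : CategoryAlgebra R C) : a * b * c = a * (b * c) := by
  induction a using induction_on with
  | zero => simp only [CategoryAlgebra.zero_mul']
  | add a a' h h' => simp only [CategoryAlgebra.add_mul', h, h']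
  | smul_of r X Y f =>
  simp only [CategoryAlgebra.smul_mul']
  congr 1
  induction b using induction_on with
  | zero => simp only [CategoryAlgebra.zero_mul', CategoryAlgebra.mul_zero']
  | add b b' h h' => simp only [CategoryAlgebra.add_mul', CategoryAlgebra.mul_add', h, h']
  | smul_of r X' Y' g =>
  simp only [CategoryAlgebra.smul_mul', CategoryAlgebra.mul_smul']
  congr 1
  induction c using induction_on with
  | zero => simp only [CategoryAlgebra.mul_zero']
  | add b b' h h' => simp only [CategoryAlgebra.mul_add', h, h']
  | smul_of r X'' Y'' k =>
  simp only [CategoryAlgebra.mul_smul']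
  congr 1
  by_cases h₁ : Y' = X
  · subst h₁
    rw [of_mul_of]
    by_cases h₂ : Y'' = X'
    · subst h₂
      simp only [of_mul_of, Category.assoc]
    · rw [of_mul_of_ne _ _ h₂, of_mul_of_ne _ _ h₂, CategoryAlgebra.mul_zero']
  · rw [of_mul_of_ne _ _ h₁, CategoryAlgebra.zero_mul']
    by_cases h₂ : Y'' = X'
    · subst h₂
      rw [of_mul_of, of_mul_of_ne _ _ h₁]
    · rw [of_mul_of_ne _ _ h₂, CategoryAlgebra.mul_zero']

protected theorem one_mul' [Finite C] (a : CategoryAlgebra R C) : 1 * a = a := by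
  have := Fintype.ofFinite C
  induction a using induction_on with
  | zero => simp only [CategoryAlgebra.mul_zero']
  | add a a' h h' => simp only [CategoryAlgebra.mul_add', h, h']
  | smul_of r X Y f =>
  rw [CategoryAlgebra.mul_smul', one_def, finsum_eq_sum_of_fintype]
  congr 1
  rw [mul_def, map_sum, LinearMap.sum_apply, Finset.sum_eq_single Y]
  · rw [← mul_def, of_mul_of, Category.comp_id]
  · intro Z _ hZ
    rw [← mul_def, of_mul_of_ne _ _ hZ.symm]
  · simp

protected theorem mul_one' [Finite C] (a : CategoryAlgebra R C) : a * 1 = a := by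
  have := Fintype.ofFinite C
  induction a using induction_on with
  | zero => simp only [CategoryAlgebra.zero_mul']
  | add a a' h h' => simp only [CategoryAlgebra.add_mul', h, h']
  | smul_of r X Y f =>
  rw [CategoryAlgebra.smul_mul', one_def, finsum_eq_sum_of_fintype]
  congr 1
  rw [mul_def, map_sum, Finset.sum_eq_single X]
  · rw [← mul_def, of_mul_of, Category.id_comp]
  · intro Z _ hZ
    rw [← mul_def, of_mul_of_ne _ _ hZ]
  · simp

/-- The category algebra of a category with finitely many objects is a unital ring. -/
instance [Finite C] : Ring (CategoryAlgebra R C) where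
  left_distrib := CategoryAlgebra.mul_add'
  right_distrib := CategoryAlgebra.add_mul'
  zero_mul := CategoryAlgebra.zero_mul'
  mul_zero := CategoryAlgebra.mul_zero'
  mul_assoc := CategoryAlgebra.mul_assoc'
  one_mul := CategoryAlgebra.one_mul'
  mul_one := CategoryAlgebra.mul_one'
  zsmul := (· • ·)
  zsmul_zero' := zero_zsmul
  zsmul_succ' := fun n a => SubNegMonoid.zsmul_succ' n a
  zsmul_neg' := fun n a => SubNegMonoid.zsmul_neg' n a
  neg_add_cancel := neg_add_cancel
  sub_eq_add_neg := sub_eq_add_neg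
  nsmul := (· • ·)
  nsmul_zero := zero_nsmul
  nsmul_succ := fun n a => AddMonoid.nsmul_succ n a

instance [Finite C] : Algebra R (CategoryAlgebra R C) :=
  Algebra.ofModule CategoryAlgebra.smul_mul' CategoryAlgebra.mul_smul'

end CategoryAlgebra

/-! ### Global dimension -/

/-- The (left) global dimension of a ring `R`: the supremum of the projective dimensions of all
(left) `R`-modules in the universe `max w u`, for `w` arbitrary. -/
def globalDimension (R : Type u) [Ring R] : WithBot ℕ∞ :=
  ⨆ M : ModuleCat.{max w u} R, projectiveDimension M

/-! ### The reachability category and the reachability poset of a quiver -/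

/-- The objects of the reachability category of a quiver `V`: the vertices of `V`. -/
def Reach (V : Type v) : Type v := V

section

variable (V : Type v) [Quiver.{w} V]

/-- The reachability preorder: `a ≤ b` if there is a (possibly trivial) path from `a` to `b`.
The reachability category is the associated thin category (`Preorder.smallCategory`): there is
exactly one morphism `a ⟶ b` if there is a path from `a` to `b`, and none otherwise. -/
instance : Preorder (Reach V) where
  le a b := Nonempty (Quiver.Path (V := V) a b)
  le_refl _ := ⟨Quiver.Path.nil⟩
  le_trans _ _ _ := fun ⟨p⟩ ⟨q⟩ => ⟨p.comp q⟩

instance [Finite V] : Finite (Reach V) := inferInstanceAs (Finite V)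

/-- The reachability poset: the posetal reflection of the reachability preorder, i.e. the vertices
modulo mutual reachability, ordered by reachability. -/
abbrev ReachPoset : Type v := Antisymmetrization (Reach V) (· ≤ ·)

instance [Finite V] : Finite (ReachPoset V) := Quotient.finite _

end

/-! ### The directed square -/

/-- The vertices of the quasi-bigon with one intermediate vertex on each of its two sides. -/
inductive SquareVertex : Type
  | x
  | v₁
  | w₁
  | y

/-- The four edges `x → v₁ → y` and `x → w₁ → y`. -/
inductive SquareEdge : SquareVertex → SquareVertex → Type
  | xv : SquareEdge .x .v₁
  | xw : SquareEdge .x .w₁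
  | vy : SquareEdge .v₁ .y
  | wy : SquareEdge .w₁ .y

instance : Quiver SquareVertex := ⟨SquareEdge⟩

/-- The poset generated by the directed square. -/
abbrev SquarePoset : Type := ReachPoset SquareVertex

end

universe r k e v

/-! A module over the category algebra of `C` is the same as a functor from `C` to vector spaces:
the idempotents `of K (𝟙 X)` sum to `1` and cut the module into its values (`toRepresentation`).
Equivalent categories therefore have equivalent module categories, and a preorder is equivalent to
its posetal reflection; this gives the equality of global dimensions.

Now let `P` be a finite poset. A relation `a < b` yields a non-projective cyclic module, so the
dimension is at least one. In a square, the two arrows out of `x` generate a left ideal whose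
commutativity relation obstructs any splitting (`not_projective_span_of_square`), so the dimension
is not one.

Without a square, distinct elements covered by the same `b` have no common lower bound. In a free
module, the values at these elements then embed as a direct sum into the value at `b`, and
submodules inherit this (`CoverIndependent`). For such a module a surjection can be split vertex by
vertex, going up the poset, because the values prescribed at `b` by its lower covers never conflict.
Hence submodules of free modules are projective and the dimension is at most one. -/

namespace CategoryTheory

-- Invariance of projective and global dimension under equivalence

universe v₁ v₂ u₁ u₂

variable {C : Type u₁} [Category.{v₁} C] [Abelian C] [EnoughProjectives C]
  {D : Type u₂} [Category.{v₂} D] [Abelian D]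

/-- An equivalence of abelian categories preserves upper bounds on the projective dimension. -/
theorem Equivalence.hasProjectiveDimensionLT_functor_obj (F : C ≌ D) (n : ℕ) (X : C)
    (hX : HasProjectiveDimensionLT X n) : HasProjectiveDimensionLT (F.functor.obj X) n := by
  have : F.functor.Additive := Functor.additive_of_preserves_binary_products _
  induction n generalizing X with
  | zero =>
    rw [hasProjectiveDimensionLT_zero_iff_isZero] at hX ⊢
    exact F.functor.map_isZero hX
  | succ n ih =>
    -- Bounds 0 and 1 mean zero and projective; from 2 on, dimension shifting along a projective
    -- presentation applies.
    cases n with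
    | zero =>
      rw [zero_add, ← projective_iff_hasProjectiveDimensionLT_one] at hX ⊢
      exact F.map_projective_iff X |>.2 hX
    | succ n =>
      let S : ShortComplex C := ShortComplex.mk (Limits.kernel.ι (Projective.π X)) (Projective.π X)
        (Limits.kernel.condition _)
      have hS : S.ShortExact :=
        { exact := ShortComplex.exact_of_f_is_kernel _ (Limits.kernelIsKernel _) }
      have hP : Projective S.X₂ := inferInstanceAs (Projective (Projective.over X))
      have h₁ := ih _ ((hS.hasProjectiveDimensionLT_X₃_iff n hP).1 hX)
      have hP' : Projective (S.map F.functor).X₂ := (F.map_projective_iff S.X₂).2 hP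
      exact ((hS.map_of_exact F.functor).hasProjectiveDimensionLT_X₃_iff n hP').2 h₁

theorem Equivalence.projectiveDimension_functor_obj_le (F : C ≌ D) (X : C) :
    projectiveDimension (F.functor.obj X) ≤ projectiveDimension X :=
  sInf_le_sInf fun _ hn i hi => F.hasProjectiveDimensionLT_functor_obj i X (hn i hi)

end CategoryTheory

universe w u

theorem globalDimension_le_of_equivalence {R S : Type u} [Ring R] [Ring S]
    (F : ModuleCat.{max w u} R ≌ ModuleCat.{max w u} S) :
    globalDimension.{w} S ≤ globalDimension.{w} R := by
  refine iSup_le fun M => ?_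
  refine (projectiveDimension_eq_of_iso (F.counitIso.app M).symm).le.trans ?_
  exact (F.projectiveDimension_functor_obj_le _).trans
    (le_iSup (fun M : ModuleCat.{max w u} R => projectiveDimension M) (F.inverse.obj M))

theorem globalDimension_eq_of_equivalence {R S : Type u} [Ring R] [Ring S]
    (F : ModuleCat.{max w u} R ≌ ModuleCat.{max w u} S) :
    globalDimension.{w} R = globalDimension.{w} S :=
  le_antisymm (globalDimension_le_of_equivalence F.symm) (globalDimension_le_of_equivalence F)

/-! ### Modules over the category algebra as representations -/

noncomputable section

namespace CategoryAlgebra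

universe W k₁ v₁ v₂

variable {K : Type k₁} [Field K] {C : Type v₁} [Category.{v₂} C] [Finite C]

theorem one_eq_sum [Fintype C] : (1 : CategoryAlgebra K C) = ∑ X : C, of K (𝟙 X) := by
  rw [one_def, finsum_eq_sum_of_fintype]

section Module

variable {M : Type*} [AddCommGroup M] [Module (CategoryAlgebra K C) M]

theorem of_smul_of_smul {X Y Z : C} (f : X ⟶ Y) (g : Y ⟶ Z) (m : M) :
    of K g • of K f • m = of K (f ≫ g) • m := by
  rw [smul_smul, of_mul_of]

theorem of_smul_of_smul_of_ne {X Y X' Y' : C} (f : X ⟶ Y) (g : X' ⟶ Y') (h : Y ≠ X') (m : M) :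
    of K g • of K f • m = 0 := by
  rw [smul_smul, of_mul_of_ne _ _ h, zero_smul]

theorem sum_of_id_smul [Fintype C] (m : M) : ∑ X : C, of K (𝟙 X) • m = m := by
  rw [← Finset.sum_smul, ← one_eq_sum, one_smul]

variable [Module K M] [IsScalarTower K (CategoryAlgebra K C) M]

variable (K M) in
/-- The summand of a module over the category algebra cut out by the identity of an object. -/
def component (X : C) : Submodule K M :=
  LinearMap.eqLocus (Algebra.lsmul K K M (of K (𝟙 X))) LinearMap.id

theorem mem_component {X : C} {m : M} : m ∈ component K M X ↔ of K (𝟙 X) • m = m :=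
  Iff.rfl

theorem of_smul_mem_component {X Y : C} (f : X ⟶ Y) (m : M) : of K f • m ∈ component K M Y := by
  rw [mem_component, of_smul_of_smul, Category.comp_id]

theorem of_smul_of_mem_component_of_ne {X Y Z : C} (f : X ⟶ Y) {m : M} (hm : m ∈ component K M Z)
    (h : Z ≠ X) : of K f • m = 0 := by
  rw [← mem_component.1 hm, of_smul_of_smul_of_ne _ _ h]

variable (K M) in
/-- The action of a morphism, as a map to the component of its target. -/
def toComponent {X Y : C} (f : X ⟶ Y) : M →ₗ[K] component K M Y :=
  (Algebra.lsmul K K M (of K f)).codRestrict _ (of_smul_mem_component f)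

@[simp]
theorem coe_toComponent {X Y : C} (f : X ⟶ Y) (m : M) :
    (toComponent K M f m : M) = of K f • m := rfl

end Module

/-- A `K`-linear map between modules over the category algebra that commutes with the action of
all morphisms is linear over the category algebra. -/
def linearMapOfCommutes {M N : Type*} [AddCommGroup M] [Module (CategoryAlgebra K C) M] [Module K M]
    [IsScalarTower K (CategoryAlgebra K C) M] [AddCommGroup N] [Module (CategoryAlgebra K C) N]
    [Module K N] [IsScalarTower K (CategoryAlgebra K C) N] (h : M →ₗ[K] N)
    (H : ∀ (X Y : C) (f : X ⟶ Y) (m : M), h (of K f • m) = of K f • h m) :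
    M →ₗ[CategoryAlgebra K C] N where
  toFun := h
  map_add' := h.map_add
  map_smul' a m := by
    induction a using induction_on with
    | zero => simp
    | add a b ha hb =>
      simp only [RingHom.id_apply] at ha hb ⊢
      rw [add_smul, map_add, ha, hb, add_smul]
    | smul_of r X Y f => simp [smul_assoc, H]

open scoped ModuleCat

variable (K C) in
/-- The functor from modules over the category algebra to representations of the category. -/
def toRepresentation :
    ModuleCat.{W} (CategoryAlgebra K C) ⥤ C ⥤ ModuleCat.{W} K where
  obj M :=
    { obj X := ModuleCat.of K (component K M X)
      map f := ModuleCat.ofHom (toComponent K M f ∘ₗ (component K M _).subtype)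
      map_id X := by
        ext m
        exact m.2
      map_comp f g := by
        ext m
        exact (of_smul_of_smul (K := K) f g m.1).symm }
  map {M N} φ :=
    { app X := ModuleCat.ofHom
        (((φ.hom.restrictScalars K) ∘ₗ (component K M X).subtype).codRestrict (component K N X)
          fun m => by
            have := congrArg φ.hom m.2
            simpa [mem_component] using this)
      naturality X Y f := by
        ext m
        exact φ.hom.map_smul (of K f) m.1 }

/-- Every element is the sum of its components, so a linear map is determined on components. -/
instance : (toRepresentation.{W} K C).Faithful where
  map_injective {M N} φ ψ h := by
    have := Fintype.ofFinite C
    ext m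
    rw [← sum_of_id_smul (K := K) (C := C) m, map_sum, map_sum]
    refine Finset.sum_congr rfl fun X _ => ?_
    have h₁ := congrArg Subtype.val (ConcreteCategory.congr_hom (NatTrans.congr_app h X)
      (toComponent K M (𝟙 X) m))
    exact h₁

instance : (toRepresentation.{W} K C).Full where
  map_surjective {M N} α := by
    have := Fintype.ofFinite C
    let a (X : C) : component K M X →ₗ[K] component K N X := (α.app X).hom
    -- Glue the maps on components along the decomposition of `M`; naturality of `α` then gives
    -- linearity over the category algebra.
    let h : M →ₗ[K] N := ∑ X : C, (component K N X).subtype ∘ₗ a X ∘ₗ toComponent K M (𝟙 X)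
    have h_apply (m : M) : h m = ∑ X : C, (a X (toComponent K M (𝟙 X) m)).1 := by
      simp [h]
    have h_of {X : C} (m : component K M X) : h m.1 = (a X m).1 := by
      rw [h_apply, Finset.sum_eq_single X]
      · congr 2
        exact Subtype.ext m.2
      · intro Y _ hY
        have : toComponent K M (𝟙 Y) m.1 = 0 :=
          Subtype.ext (of_smul_of_mem_component_of_ne (𝟙 Y) m.2 hY.symm)
        rw [this, map_zero, ZeroMemClass.coe_zero]
      · simp
    have H (X Y : C) (f : X ⟶ Y) (m : M) : h (of K f • m) = of K f • h m := by
      have h₁ : h (of K f • m) = of K f • h (toComponent K M (𝟙 X) m).1 := by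
        have e := congrArg Subtype.val (ConcreteCategory.congr_hom (α.naturality f)
          (toComponent K M (𝟙 X) m))
        have e' : of K f • m = of K f • (toComponent K M (𝟙 X) m).1 := by
          rw [coe_toComponent, of_smul_of_smul, Category.id_comp]
        rw [e', h_of]
        exact (h_of (toComponent K M f (toComponent K M (𝟙 X) m).1)).trans e
      rw [h₁, h_of, h_apply, Finset.smul_sum, Finset.sum_eq_single X]
      · intro Y _ hY
        exact of_smul_of_mem_component_of_ne f (a Y _).2 hY
      · simp
    refine ⟨ModuleCat.ofHom (linearMapOfCommutes h H), ?_⟩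
    ext X m
    refine Subtype.ext ?_
    exact h_of m

section EssSurj

variable {C : Type v₁} [Category.{v₂} C] (N : C ⥤ ModuleCat.{W} K)

open Classical in
/-- The action of a morphism on the product of the values of a representation. -/
def piAction {X Y : C} (f : X ⟶ Y) : Module.End K (∀ X, N.obj X) :=
  LinearMap.single K (fun X => N.obj X) Y ∘ₗ (N.map f).hom ∘ₗ LinearMap.proj X

theorem piAction_apply_self {X Y : C} (f : X ⟶ Y) (p : ∀ X, N.obj X) :
    piAction N f p Y = N.map f (p X) := by
  classical
  simp [piAction]

theorem piAction_apply_of_ne {X Y Z : C} (f : X ⟶ Y) (p : ∀ X, N.obj X) (h : Z ≠ Y) :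
    piAction N f p Z = 0 := by
  classical
  simp [piAction, h]

theorem piAction_mul {X Y Z : C} (f : Y ⟶ Z) (g : X ⟶ Y) :
    piAction N f * piAction N g = piAction N (g ≫ f) := by
  ext1 p
  simp [piAction]

theorem piAction_mul_of_ne {X Y X' Y' : C} (f : X ⟶ Y) (g : X' ⟶ Y') (h : Y' ≠ X) :
    piAction N f * piAction N g = 0 := by
  ext p Z
  rw [Module.End.mul_apply]
  by_cases hZ : Z = Y
  · subst hZ
    rw [piAction_apply_self, piAction_apply_of_ne _ _ _ h.symm, map_zero]
    rfl
  · rw [piAction_apply_of_ne _ _ _ hZ]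
    rfl

/-- The algebra map giving the module associated with a representation. -/
def piActionHom [Finite C] : CategoryAlgebra K C →+* Module.End K (∀ X, N.obj X) where
  toFun := lift K fun f => piAction N f.2.2
  map_zero' := map_zero _
  map_add' := map_add _
  map_one' := by
    have := Fintype.ofFinite C
    classical
    rw [one_eq_sum, map_sum]
    simp only [lift_of]
    ext p Y
    simp [piAction, Finset.sum_apply]
  map_mul' a b := by
    induction a using induction_on with
    | zero => simp
    | add a a' h h' => rw [add_mul, map_add, h, h', map_add, add_mul]
    | smul_of r X Y f =>
      rw [smul_mul_assoc, map_smul, map_smul, smul_mul_assoc]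
      congr 1
      induction b using induction_on with
      | zero => simp
      | add a a' h h' => rw [mul_add, map_add, h, h', map_add, mul_add]
      | smul_of r X' Y' g =>
        rw [mul_smul_comm, map_smul, map_smul, mul_smul_comm]
        congr 1
        by_cases h : Y' = X
        · subst h
          rw [of_mul_of, lift_of, lift_of, lift_of, piAction_mul]
        · rw [of_mul_of_ne _ _ h, map_zero, lift_of, lift_of, piAction_mul_of_ne _ _ _ h]


variable [Finite C]

/-- The module over the category algebra associated with a representation. -/
def PiModule (N : C ⥤ ModuleCat.{W} K) : Type (max v₁ W) := ∀ X, N.obj X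

instance : AddCommGroup (PiModule N) := inferInstanceAs (AddCommGroup (∀ X, N.obj X))

instance : Module (CategoryAlgebra K C) (PiModule N) :=
  Module.compHom (∀ X, N.obj X) (piActionHom N)

instance : Module K (PiModule N) := Module.restrictScalars K (CategoryAlgebra K C) (PiModule N)

instance : IsScalarTower K (CategoryAlgebra K C) (PiModule N) :=
  IsScalarTower.restrictScalars K (CategoryAlgebra K C) (PiModule N)

variable {N}

theorem smul_piModule_apply (a : CategoryAlgebra K C) (p : PiModule N) (Y : C) :
    (a • p) Y = (piActionHom N a p) Y := rfl

theorem of_smul_piModule_apply {X Y : C} (f : X ⟶ Y) (p : PiModule N) (Z : C) :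
    (of K f • p) Z = (piAction N f p) Z := by
  rw [smul_piModule_apply]
  exact congrFun (congrArg (fun φ : Module.End K (∀ X, N.obj X) => φ p)
    (lift_of K (fun f => piAction N f.2.2) f)) Z

theorem of_smul_piModule_apply_self {X Y : C} (f : X ⟶ Y) (p : PiModule N) :
    (of K f • p) Y = N.map f (p X) := by
  rw [of_smul_piModule_apply]
  exact piAction_apply_self N f p

theorem of_smul_piModule_apply_of_ne {X Y Z : C} (f : X ⟶ Y) (p : PiModule N) (h : Z ≠ Y) :
    (of K f • p) Z = 0 := by
  rw [of_smul_piModule_apply]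
  exact piAction_apply_of_ne N f p h

theorem scalar_smul_piModule_apply (r : K) (p : PiModule N) (Y : C) : (r • p) Y = r • p Y := by
  have h : piActionHom N (algebraMap K _ r) = algebraMap K _ r := by
    rw [Algebra.algebraMap_eq_smul_one, Algebra.algebraMap_eq_smul_one, ← (piActionHom N).map_one]
    exact map_smul (lift K fun f => piAction N f.2.2) r 1
  rw [← algebraMap_smul (CategoryAlgebra K C) r p, smul_piModule_apply, h]
  rfl

theorem component_piModule_apply_of_ne {X Y : C} (p : component K (PiModule N) X) (h : Y ≠ X) :
    p.1 Y = 0 := by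
  rw [← mem_component.1 p.2, of_smul_piModule_apply_of_ne _ _ h]

/-- The components of the module associated with a representation are the values of the
representation. -/
def componentPiModule (N : C ⥤ ModuleCat.{W} K) (X : C) :
    component K (PiModule N) X ≃ₗ[K] N.obj X :=
  LinearEquiv.ofBijective
    { toFun p := p.1 X
      map_add' _ _ := rfl
      map_smul' r p := scalar_smul_piModule_apply r p.1 X }
    ⟨fun p q h => by
      replace h : p.1 X = q.1 X := h
      refine Subtype.ext (funext fun Y => ?_)
      by_cases hY : Y = X
      · exact hY ▸ h
      · rw [component_piModule_apply_of_ne p hY, component_piModule_apply_of_ne q hY],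
    fun n => by
      classical
      let p : PiModule N := fun Y => (Pi.single X n : ∀ X, N.obj X) Y
      refine ⟨⟨of K (𝟙 X) • p, of_smul_mem_component _ _⟩, ?_⟩
      change (of K (𝟙 X) • p) X = n
      rw [of_smul_piModule_apply_self]
      simp [p]⟩

end EssSurj

/-- The preimage is a product over all objects, which is why the universe must absorb `v₁`. -/
instance : (toRepresentation.{max W v₁} K C).EssSurj where
  mem_essImage N := by
    refine ⟨ModuleCat.of (CategoryAlgebra K C) (PiModule N), ⟨NatIso.ofComponents
      (fun X => LinearEquiv.toModuleIso (componentPiModule N X)) fun f => ?_⟩⟩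
    ext p
    exact of_smul_piModule_apply_self f p.1

instance : (toRepresentation.{max W v₁} K C).IsEquivalence where

end CategoryAlgebra

end

/-! ### Passage from a preorder to its poset -/

section

/-- The category algebras of equivalent categories have the same global dimension. -/
theorem globalDimension_categoryAlgebra_eq_of_equivalence (K : Type k) [Field K] {C D : Type v}
    [Category.{v} C] [Category.{v} D] [Finite C] [Finite D] (F : C ≌ D) :
    globalDimension.{r} (CategoryAlgebra K C) = globalDimension.{r} (CategoryAlgebra K D) :=
  globalDimension_eq_of_equivalence
    (((CategoryAlgebra.toRepresentation.{max r k v} K C).asEquivalence.trans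
      F.congrLeft).trans
        (CategoryAlgebra.toRepresentation.{max r k v} K D).asEquivalence.symm)

/-- The posetal reflection of a preorder is equivalent to it as a category. -/
noncomputable def antisymmetrizationEquivalence (P : Type v) [Preorder P] :
    P ≌ Antisymmetrization P (· ≤ ·) :=
  let F : P ⥤ Antisymmetrization P (· ≤ ·) := (toAntisymmetrization_mono (α := P)).functor
  have : F.Full := ⟨fun f => ⟨homOfLE (leOfHom f), Subsingleton.elim _ _⟩⟩
  have : F.Faithful := ⟨fun _ => Subsingleton.elim _ _⟩
  have : F.EssSurj := ⟨fun Y => ⟨ofAntisymmetrization (· ≤ ·) Y,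
    ⟨eqToIso (toAntisymmetrization_ofAntisymmetrization (· ≤ ·) Y)⟩⟩⟩
  have : F.IsEquivalence := { }
  F.asEquivalence

end

/-! ### Coefficients and non-projective modules -/

namespace CategoryAlgebra

section Coeff

variable {K : Type k} [Field K] {P : Type v} [PartialOrder P]

open Classical in
/-- The coefficient of the morphism `a ⟶ b` in an element of the category algebra of a poset, which
is zero if `¬ a ≤ b`. -/
noncomputable def coeff (a b : P) : CategoryAlgebra K P →ₗ[K] K :=
  lift K fun f => if f.1 = a ∧ f.2.1 = b then 1 else 0

open Classical in
theorem coeff_of {a b X Y : P} (f : X ⟶ Y) :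
    coeff a b (of K f) = if X = a ∧ Y = b then 1 else 0 :=
  lift_of K _ f

theorem coeff_of_self {a b : P} (f : a ⟶ b) : coeff a b (of K f) = 1 := by
  simp [coeff_of]

theorem coeff_eq_zero_of_not_le {a b : P} (h : ¬ a ≤ b) (x : CategoryAlgebra K P) :
    coeff a b x = 0 := by
  induction x using induction_on with
  | zero => simp
  | add x y hx hy => simp [hx, hy]
  | smul_of r X Y f =>
    rw [map_smul, coeff_of, if_neg, smul_zero]
    rintro ⟨rfl, rfl⟩
    exact h (leOfHom f)

/-- Composition with `f` only relabels targets from `X` to `Y`, and thinness keeps distinct basis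
elements distinct. -/
theorem coeff_of_mul {X Y : P} (f : X ⟶ Y) (a : P) (x : CategoryAlgebra K P) :
    coeff a Y (of K f * x) = coeff a X x := by
  induction x using induction_on with
  | zero => simp [CategoryAlgebra.mul_zero']
  | add x y hx hy => simp [CategoryAlgebra.mul_add', hx, hy]
  | smul_of r X' Y' g =>
    rw [CategoryAlgebra.mul_smul', map_smul, map_smul]
    by_cases h : Y' = X
    · subst h
      rw [of_mul_of, coeff_of, coeff_of]
      congr 1
      split_ifs <;> first | rfl | tauto
    · rw [of_mul_of_ne _ _ h, coeff_of, if_neg (by tauto), map_zero]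

theorem coeff_mul_of {X Y : P} (f : X ⟶ Y) (b : P) (x : CategoryAlgebra K P) :
    coeff X b (x * of K f) = coeff Y b x := by
  induction x using induction_on with
  | zero => simp [CategoryAlgebra.zero_mul']
  | add x y hx hy => simp [CategoryAlgebra.add_mul', hx, hy]
  | smul_of r X' Y' g =>
    rw [CategoryAlgebra.smul_mul', map_smul, map_smul]
    by_cases h : Y = X'
    · subst h
      rw [of_mul_of, coeff_of, coeff_of]
      congr 1
      split_ifs <;> first | rfl | tauto
    · rw [of_mul_of_ne _ _ h, coeff_of, if_neg (by tauto), map_zero]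

theorem coeff_eq_apply {a b : P} (f : a ⟶ b) (x : CategoryAlgebra K P) :
    coeff a b x = (show (Σ X Y : P, X ⟶ Y) →₀ K from x) ⟨a, b, f⟩ := by
  classical
  refine (Finsupp.lift_apply _ _ _ _ _).trans ?_
  refine (Finsupp.sum_eq_single (⟨a, b, f⟩ : Σ X Y : P, X ⟶ Y) ?_ ?_).trans ?_
  · rintro ⟨X, Y, g⟩ _ hne
    rw [if_neg, smul_zero]
    rintro ⟨rfl, rfl⟩
    exact hne (by rw [Subsingleton.elim f g])
  · simp
  · simp

theorem eq_zero_of_coeff {x : CategoryAlgebra K P} (h : ∀ a b : P, coeff a b x = 0) : x = 0 := by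
  refine Finsupp.ext (M := K) ?_
  rintro ⟨a, b, f⟩
  exact (coeff_eq_apply f x).symm.trans (h a b)

theorem coeff_of_mul_of_ne {X Y : P} (f : X ⟶ Y) (a : P) {b : P} (h : b ≠ Y)
    (x : CategoryAlgebra K P) : coeff a b (of K f * x) = 0 := by
  induction x using induction_on with
  | zero => simp [CategoryAlgebra.mul_zero']
  | add x y hx hy => simp [CategoryAlgebra.mul_add', hx, hy]
  | smul_of r X' Y' g =>
    rw [CategoryAlgebra.mul_smul', map_smul]
    by_cases h' : Y' = X
    · subst h'
      rw [of_mul_of, coeff_of, if_neg (by tauto), smul_zero]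
    · rw [of_mul_of_ne _ _ h', map_zero, smul_zero]

theorem of_mul_eq_zero {X Y : P} (f : X ⟶ Y) {x : CategoryAlgebra K P}
    (h : ∀ a, coeff a X x = 0) : of K f * x = 0 := by
  refine eq_zero_of_coeff fun a b => ?_
  by_cases hb : b = Y
  · subst hb
    rw [coeff_of_mul, h]
  · exact coeff_of_mul_of_ne f a hb x

variable [Finite P]

/-- A splitting would make the arrow `r : a ⟶ b` von Neumann regular, `r = r * y * r`. The
coefficient of this product at `(a, b)` is that of `y` at `(b, a)`, which vanishes. -/
theorem not_projective_quotient_span_of {a b : P} (hab : a < b) :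
    ¬ Module.Projective (CategoryAlgebra K P)
      (CategoryAlgebra K P ⧸ Submodule.span (CategoryAlgebra K P) {of K (homOfLE hab.le)}) := by
  set r : CategoryAlgebra K P := of K (homOfLE hab.le)
  set I := Submodule.span (CategoryAlgebra K P) {r}
  rw [Module.Projective.iff_split_of_projective I.mkQ I.mkQ_surjective]
  rintro ⟨i, hi⟩
  have hr : r * i (I.mkQ 1) = 0 := by
    rw [← smul_eq_mul, ← map_smul, ← map_smul, smul_eq_mul, mul_one, Submodule.mkQ_apply,
      (Submodule.Quotient.mk_eq_zero I).2 (Submodule.mem_span_singleton_self r), map_zero]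
  have h₁ : 1 - i (I.mkQ 1) ∈ I := by
    rw [← Submodule.Quotient.mk_eq_zero, ← Submodule.mkQ_apply, map_sub, sub_eq_zero]
    exact (LinearMap.congr_fun hi (I.mkQ 1)).symm
  obtain ⟨y, hy⟩ := Submodule.mem_span_singleton.1 h₁
  have h₂ : r * (y * r) = r := by
    rw [← smul_eq_mul y r, hy, mul_sub, mul_one, hr, sub_zero]
  have h₃ : coeff a b (r * (y * r)) = 0 := by
    rw [coeff_of_mul, coeff_mul_of, coeff_eq_zero_of_not_le hab.not_ge]
  rw [h₂, coeff_of_self] at h₃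
  exact one_ne_zero h₃

/-- Split the surjection from the free module on two generators and apply the section to the
relation `(v ⟶ y) α = (w ⟶ y) β`. In the first coordinate, the coefficient at `(v, y)` is 1 on the
left and, since `¬ v ≤ w`, 0 on the right. -/
theorem not_projective_span_of_square {x v w y : P} (hxv : x ≤ v) (hxw : x ≤ w) (hvy : v ≤ y)
    (hwy : w ≤ y) (hvw : ¬ v ≤ w) (hwv : ¬ w ≤ v) :
    ¬ Module.Projective (CategoryAlgebra K P) (Submodule.span (CategoryAlgebra K P)
      {of K (homOfLE hxv), of K (homOfLE hxw)}) := by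
  set α : CategoryAlgebra K P := of K (homOfLE hxv)
  set β : CategoryAlgebra K P := of K (homOfLE hxw)
  set N := Submodule.span (CategoryAlgebra K P) {α, β}
  have hα : α ∈ N := Submodule.subset_span (by simp)
  have hβ : β ∈ N := Submodule.subset_span (by simp)
  let q : CategoryAlgebra K P × CategoryAlgebra K P →ₗ[CategoryAlgebra K P] N :=
    LinearMap.coprod (LinearMap.toSpanSingleton _ _ ⟨α, hα⟩)
      (LinearMap.toSpanSingleton _ _ ⟨β, hβ⟩)
  have hq_apply (p) : (q p : CategoryAlgebra K P) = p.1 * α + p.2 * β := by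
    simp [q]
  have hq : Function.Surjective q := by
    rintro ⟨n, hn⟩
    obtain ⟨s, t, h⟩ := Submodule.mem_span_pair.1 hn
    exact ⟨(s, t), Subtype.ext ((hq_apply _).trans h)⟩
  rw [Module.Projective.iff_split_of_projective q hq]
  rintro ⟨σ, hσ⟩
  -- Compare coefficients at `(x, v)` in `s * α + t * β = α`; `t` does not contribute because `¬ w ≤
  -- v`.
  have h₁ : coeff v v (σ ⟨α, hα⟩).1 = 1 := by
    have e := congrArg (fun n : N => coeff x v n.1) (LinearMap.congr_fun hσ ⟨α, hα⟩)
    simp only [LinearMap.comp_apply, hq_apply, LinearMap.id_apply, map_add] at e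
    rwa [coeff_mul_of, coeff_mul_of, coeff_eq_zero_of_not_le hwv, add_zero, coeff_of_self] at e
  have h₂ : of K (homOfLE hvy) • (⟨α, hα⟩ : N) = of K (homOfLE hwy) • (⟨β, hβ⟩ : N) :=
    Subtype.ext ((of_mul_of _ _).trans (of_mul_of (homOfLE hwy) (homOfLE hxw)).symm)
  have h₃ := congrArg (fun n : N => coeff v y (σ n).1) h₂
  simp only [map_smul, Prod.smul_fst, smul_eq_mul] at h₃
  rw [coeff_of_mul, coeff_of_mul, h₁, coeff_eq_zero_of_not_le hvw] at h₃
  exact one_ne_zero h₃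

end Coeff

end CategoryAlgebra

/-! ### Criteria for global dimension one -/

section GlobalDimension

variable {R : Type u} [Ring R]

/-- A ring all of whose submodules of free modules are projective has global dimension at most
one. -/
theorem globalDimension_le_one_of_projective_submodules
    (H : ∀ (ι : Type (max w u)) (N : Submodule R (ι →₀ R)), Module.Projective R N) :
    globalDimension.{w} R ≤ 1 := by
  refine iSup_le fun M => ?_
  have hf : Function.Surjective (Finsupp.linearCombination R (id : M → M)) :=
    Finsupp.linearCombination_id_surjective R M
  have hS := LinearMap.shortExact_shortComplexKer hf
  refine (projectiveDimension_le_iff M 1).2 ((hS.hasProjectiveDimensionLT_X₃_iff 0 ?_).2 ?_)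
  · exact (IsProjective.iff_projective (M →₀ R)).1 inferInstance
  · rw [zero_add, ← projective_iff_hasProjectiveDimensionLT_one]
    exact (IsProjective.iff_projective _).1 (H M _)

/-- Dimension shifting in `0 → I → R → R / I → 0`, carried out after `ULift` so that the modules lie
in the universe over which the supremum runs. -/
theorem projective_submodule_of_globalDimension_le_one (h : globalDimension.{w} R ≤ 1)
    (I : Submodule R R) : Module.Projective R I := by
  let e : ULift.{w} R ≃ₗ[R] R := ULift.moduleEquiv
  let I' : Submodule R (ULift.{w} R) := I.comap e.toLinearMap
  have hS := LinearMap.shortExact_shortComplexKer I'.mkQ_surjective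
  have h₃ : HasProjectiveDimensionLT (ModuleCat.of R (ULift.{w} R ⧸ I')) 2 :=
    (projectiveDimension_le_iff _ 1).1
      ((le_iSup (fun M : ModuleCat.{max w u} R => projectiveDimension M) _).trans h)
  have h₁ := (hS.hasProjectiveDimensionLT_X₃_iff 0
    ((IsProjective.iff_projective (ULift.{w} R)).1 inferInstance)).1 h₃
  rw [zero_add, ← projective_iff_hasProjectiveDimensionLT_one] at h₁
  have h₂ : Module.Projective R (LinearMap.ker I'.mkQ) := (IsProjective.iff_projective _).2 h₁
  rw [Submodule.ker_mkQ] at h₂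
  exact Module.Projective.of_equiv' (e.ofSubmodule' I)

theorem one_le_globalDimension {I : Submodule R R} (h : ¬ Module.Projective R (R ⧸ I)) :
    1 ≤ globalDimension.{w} R := by
  refine le_trans ?_ (le_iSup (fun M : ModuleCat.{max w u} R => projectiveDimension M)
    (ModuleCat.of R (ULift.{w} (R ⧸ I))))
  refine (projectiveDimension_ge_iff _ 1).2 fun h' => h ?_
  rw [← projective_iff_hasProjectiveDimensionLT_one, ← IsProjective.iff_projective] at h'
  exact Module.Projective.of_ulift

end GlobalDimension

/-- Every linear map of vector spaces is von Neumann regular. -/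
theorem LinearMap.exists_comp_comp_eq_self {K V W : Type*} [Field K] [AddCommGroup V] [Module K V]
    [AddCommGroup W] [Module K W] (T : V →ₗ[K] W) :
    ∃ r : W →ₗ[K] V, ∀ v, T (r (T v)) = T v := by
  -- Take a section of `T` over its range and extend it to all of `W`.
  obtain ⟨s, hs⟩ := T.rangeRestrict.exists_rightInverse_of_surjective T.range_rangeRestrict
  obtain ⟨r, hr⟩ := LinearMap.exists_extend s
  refine ⟨r, fun v => ?_⟩
  have h₁ : r (T v) = s (T.rangeRestrict v) := LinearMap.congr_fun hr (T.rangeRestrict v)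
  have h₂ := congrArg Subtype.val (LinearMap.congr_fun hs (T.rangeRestrict v))
  rw [h₁]
  exact h₂

/-! ### Cover-independent representations are projective -/

namespace CategoryAlgebra

variable {K : Type k} [Field K] {P : Type v} [PartialOrder P] [Finite P]

variable (K P) in
/-- A representation of a finite poset is cover-independent if, for each `b`, its values at the
elements covered by `b` embed as a direct sum into its value at `b`. -/
def CoverIndependent (M : Type*) [AddCommGroup M] [Module (CategoryAlgebra K P) M] : Prop :=
  ∀ (b : P) (m : {a // a ⋖ b} → M), ∑ᶠ a, of K (homOfLE a.2.le) • m a = 0 →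
    ∀ a, of K (𝟙 a.1) • m a = 0

theorem CoverIndependent.of_injective {M N : Type*} [AddCommGroup M]
    [Module (CategoryAlgebra K P) M] [AddCommGroup N] [Module (CategoryAlgebra K P) N]
    (hN : CoverIndependent K P N) (f : M →ₗ[CategoryAlgebra K P] N) (hf : Function.Injective f) :
    CoverIndependent K P M := by
  have := Fintype.ofFinite P
  intro b m hm a
  refine hf ?_
  rw [map_smul, map_zero]
  refine hN b (fun a => f (m a)) ?_ a
  rw [← map_zero f, ← hm, map_finsum f (Set.toFinite _)]
  simp

/-- Read off the coefficient at `(c, b)`: by `hP` at most one element covered by `b` lies above `c`,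
so only one summand contributes and its coefficient must vanish. -/
theorem coverIndependent_finsupp
    (hP : ∀ {a a' b c : P}, c ≤ a → c ≤ a' → a ⋖ b → a' ⋖ b → a = a') (ι : Type*) :
    CoverIndependent K P (ι →₀ CategoryAlgebra K P) := by
  classical
  have := Fintype.ofFinite P
  intro b m hm a
  ext1 i
  refine of_mul_eq_zero _ fun c => ?_
  by_cases hc : c ≤ a.1
  · have h := congrArg (fun n : ι →₀ CategoryAlgebra K P => coeff c b (n i)) hm
    simp only [finsum_eq_sum_of_fintype, Finsupp.finsetSum_apply, map_sum, Finsupp.smul_apply,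
      smul_eq_mul, coeff_of_mul, Finsupp.zero_apply, map_zero] at h
    rwa [Finset.sum_eq_single a] at h
    · intro a' _ ha'
      refine coeff_eq_zero_of_not_le (fun hc' => ha' ?_) _
      exact Subtype.ext (hP hc' hc a'.2 a.2)
    · simp
  · exact coeff_eq_zero_of_not_le hc _

section Splitting

variable {M N : Type*} [AddCommGroup M] [Module (CategoryAlgebra K P) M] [AddCommGroup N]
  [Module (CategoryAlgebra K P) N] [Module K M] [IsScalarTower K (CategoryAlgebra K P) M]
  [Module K N] [IsScalarTower K (CategoryAlgebra K P) N]

/-- A linear section `s` becomes compatible with the vertex idempotents `e_X` on replacing it by `∑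
e_X s e_X`. This is the start of the induction. -/
theorem exists_section_commuting_id (f : N →ₗ[CategoryAlgebra K P] M)
    (hf : Function.Surjective f) :
    ∃ h : M →ₗ[K] N, (∀ m, f (h m) = m) ∧
      ∀ (X : P) m, h (of K (𝟙 X) • m) = of K (𝟙 X) • h m := by
  have := Fintype.ofFinite P
  obtain ⟨s, hs⟩ := (f.restrictScalars K).exists_rightInverse_of_surjective
    (LinearMap.range_eq_top.2 hf)
  replace hs (m : M) : f (s m) = m := LinearMap.congr_fun hs m
  let h : M →ₗ[K] N := ∑ X : P, Algebra.lsmul K K N (of K (𝟙 X)) ∘ₗ s ∘ₗ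
    Algebra.lsmul K K M (of K (𝟙 X))
  have h_apply (m : M) : h m = ∑ X : P, of K (𝟙 X) • s (of K (𝟙 X) • m) := by
    simp [h]
  refine ⟨h, fun m => ?_, fun X m => ?_⟩
  · rw [h_apply, map_sum]
    simp only [map_smul, hs, of_smul_of_smul, Category.comp_id]
    exact sum_of_id_smul m
  · rw [h_apply, h_apply, Finset.smul_sum]
    refine Finset.sum_congr rfl fun Y _ => ?_
    by_cases hY : Y = X
    · subst hY
      rw [of_smul_of_smul, of_smul_of_smul, Category.comp_id]
    · rw [of_smul_of_smul_of_ne _ _ (Ne.symm hY), map_zero, smul_zero,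
        of_smul_of_smul_of_ne _ _ hY]

/-- The inductive step in the construction of a section: a `K`-linear map that is compatible with
morphisms to the targets below `b` can be corrected at `b`. -/
theorem CoverIndependent.exists_correction (hM : CoverIndependent K P M)
    (f : N →ₗ[CategoryAlgebra K P] M) (h : M →ₗ[K] N) (hf : ∀ m, f (h m) = m)
    (h_id : ∀ (X : P) m, h (of K (𝟙 X) • m) = of K (𝟙 X) • h m) (b : P) :
    ∃ Q : M →ₗ[K] N, (∀ m, f (Q m) = m) ∧ ∀ (a : P) (hab : a ⋖ b) (m : M),
      Q (of K (homOfLE hab.le) • m) = of K (homOfLE hab.le) • h m := by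
  classical
  have := Fintype.ofFinite P
  -- `T` collects what reaches `b` from its lower covers in `M`, and `S` does the same in `N` after
  -- lifting by `h`. The correction must satisfy `Q ∘ T = S`.
  let T : ({a // a ⋖ b} → M) →ₗ[K] M :=
    ∑ a, Algebra.lsmul K K M (of K (homOfLE a.2.le)) ∘ₗ LinearMap.proj a
  let S : ({a // a ⋖ b} → M) →ₗ[K] N :=
    ∑ a, Algebra.lsmul K K N (of K (homOfLE a.2.le)) ∘ₗ h ∘ₗ LinearMap.proj a
  have T_apply (p) : T p = ∑ a, of K (homOfLE a.2.le) • p a := by simp [T]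
  have S_apply (p) : S p = ∑ a, of K (homOfLE a.2.le) • h (p a) := by simp [S]
  have fS (p) : f (S p) = T p := by simp [S_apply, T_apply, hf]
  -- Consistency of the prescription `Q ∘ T = S`; this is where cover-independence enters.
  have S_eq_zero (p) (hp : T p = 0) : S p = 0 := by
    rw [S_apply]
    refine Finset.sum_eq_zero fun a _ => ?_
    have h₀ : of K (𝟙 a.1) • p a = 0 :=
      hM b p (by rw [finsum_eq_sum_of_fintype, ← T_apply, hp]) a
    have h₁ := of_smul_of_smul (K := K) (𝟙 a.1) (homOfLE a.2.le) (h (p a))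
    rw [Category.id_comp] at h₁
    rw [← h₁, ← h_id, h₀, map_zero, smul_zero]
  obtain ⟨r, hr⟩ := T.exists_comp_comp_eq_self
  -- With `T r T = T`, the map `T r` projects onto the range of `T`. `Q` is the prescribed lift `S
  -- r` on that range and `h` on the complement.
  let Q : M →ₗ[K] N := S ∘ₗ r + h - h ∘ₗ T ∘ₗ r
  have Q_apply (m) : Q m = S (r m) + h m - h (T (r m)) := rfl
  refine ⟨Q, fun m => ?_, fun a hab m => ?_⟩
  · simp [Q_apply, fS, hf]
  · have hT : of K (homOfLE hab.le) • m = T (Pi.single ⟨a, hab⟩ m) := by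
      rw [T_apply, Finset.sum_eq_single ⟨a, hab⟩]
      · simp
      · intro c _ hc
        rw [Pi.single_eq_of_ne hc, smul_zero]
      · simp
    have hS : of K (homOfLE hab.le) • h m = S (Pi.single ⟨a, hab⟩ m) := by
      rw [S_apply, Finset.sum_eq_single ⟨a, hab⟩]
      · simp
      · intro c _ hc
        rw [Pi.single_eq_of_ne hc, map_zero, smul_zero]
      · simp
    rw [hT, hS, Q_apply, hr, add_sub_cancel_right, ← sub_eq_zero, ← map_sub]
    exact S_eq_zero _ (by rw [map_sub, hr, sub_self])

/-- Induction removing a maximal `b` from `U`: only the component of the section at `b` needs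
changing, and no arrow leads from `b` to another element of `U`. -/
theorem CoverIndependent.exists_section_of_isLowerSet (hM : CoverIndependent K P M)
    (f : N →ₗ[CategoryAlgebra K P] M) (hf : Function.Surjective f) (U : Finset P)
    (hU : IsLowerSet (U : Set P)) :
    ∃ h : M →ₗ[K] N, (∀ m, f (h m) = m) ∧
      (∀ (X : P) m, h (of K (𝟙 X) • m) = of K (𝟙 X) • h m) ∧
      ∀ (X Y : P) (g : X ⟶ Y), Y ∈ U → ∀ m, h (of K g • m) = of K g • h m := by
  classical
  induction U using Finset.strongInduction with
  | H U ih =>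
  rcases U.eq_empty_or_nonempty with rfl | hne
  · obtain ⟨h, h₁, h₂⟩ := exists_section_commuting_id f hf
    exact ⟨h, h₁, h₂, by simp⟩
  obtain ⟨b, hb⟩ := U.exists_maximal hne
  have hU' : IsLowerSet ((U.erase b : Finset P) : Set P) := by
    intro x y hyx hx
    simp only [Finset.coe_erase, Set.mem_sdiff, Finset.mem_coe, Set.mem_singleton_iff] at hx ⊢
    refine ⟨hU hyx hx.1, ?_⟩
    rintro rfl
    exact hx.2 (le_antisymm (hb.2 hx.1 hyx) hyx)
  obtain ⟨h, h₁, h₂, h₃⟩ := ih _ (Finset.erase_ssubset hb.1) hU'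
  obtain ⟨Q, hQ₁, hQ₂⟩ := hM.exists_correction f h h₁ h₂ b
  -- Replace the `b`-component of `h` by that of `Q` and leave the other components alone.
  let h' : M →ₗ[K] N := h - Algebra.lsmul K K N (of K (𝟙 b)) ∘ₗ h +
    Algebra.lsmul K K N (of K (𝟙 b)) ∘ₗ Q ∘ₗ Algebra.lsmul K K M (of K (𝟙 b))
  have h'_apply (m : M) :
      h' m = h m - of K (𝟙 b) • h m + of K (𝟙 b) • Q (of K (𝟙 b) • m) := rfl
  have h'_of {X : P} (g : X ⟶ b) (m : M) : h' (of K g • m) = of K (𝟙 b) • Q (of K g • m) := by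
    have h₄ : h (of K g • m) = of K (𝟙 b) • h (of K g • m) := by
      rw [← h₂, of_smul_of_smul, Category.comp_id]
    rw [h'_apply, of_smul_of_smul, Category.comp_id, ← h₄, sub_self, zero_add]
  have h'_of_ne {X Y : P} (g : X ⟶ Y) (hY : Y ≠ b) (m : M) :
      h' (of K g • m) = h (of K g • m) := by
    have h₄ : of K (𝟙 b) • h (of K g • m) = 0 := by
      rw [← h₂, of_smul_of_smul_of_ne _ _ hY, map_zero]
    rw [h'_apply, h₄, of_smul_of_smul_of_ne _ _ hY, map_zero, smul_zero, sub_zero, add_zero]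
  have of_h' {X Y : P} (g : X ⟶ Y) (hX : X ≠ b) (m : M) : of K g • h' m = of K g • h m := by
    rw [h'_apply, smul_add, smul_sub, of_smul_of_smul_of_ne _ _ hX.symm,
      of_smul_of_smul_of_ne _ _ hX.symm, sub_zero, add_zero]
  have h'_id (X : P) (m : M) : h' (of K (𝟙 X) • m) = of K (𝟙 X) • h' m := by
    by_cases hX : X = b
    · subst hX
      rw [h'_of, h'_apply, smul_add, smul_sub, of_smul_of_smul, of_smul_of_smul,
        Category.comp_id, sub_self, zero_add]
    · rw [h'_of_ne _ hX, of_h' _ hX, h₂]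
  refine ⟨h', fun m => ?_, h'_id, fun X Y g hY m => ?_⟩
  · rw [h'_apply, map_add, map_sub, map_smul, map_smul, h₁, hQ₁, of_smul_of_smul,
      Category.comp_id, sub_add_cancel]
  · by_cases hYb : Y = b
    · subst hYb
      by_cases hX : X = Y
      · subst hX
        rw [Subsingleton.elim g (𝟙 X)]
        exact h'_id X m
      -- A non-identity arrow into `b` factors through a lower cover `a`: the induction hypothesis
      -- handles `X ⟶ a`, and the defining property of `Q` handles the covering arrow.
      · obtain ⟨a, hXa, haY⟩ := exists_le_covBy_of_lt (lt_of_le_of_ne (leOfHom g) hX)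
        have hg : g = homOfLE hXa ≫ homOfLE haY.le := Subsingleton.elim _ _
        have haU : a ∈ U.erase Y := Finset.mem_erase.2 ⟨haY.ne, hU haY.le hY⟩
        rw [h'_of, of_h' _ hX, hg, ← of_smul_of_smul, hQ₂ _ haY, h₃ _ _ _ haU, of_smul_of_smul,
          of_smul_of_smul, Category.comp_id]
    · have hX : X ≠ b := by
        rintro rfl
        exact hYb (le_antisymm (hb.2 hY (leOfHom g)) (leOfHom g))
      rw [h'_of_ne g hYb, of_h' g hX, h₃ _ _ g (Finset.mem_erase.2 ⟨hYb, hY⟩)]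

end Splitting

theorem CoverIndependent.projective {M : Type*} [AddCommGroup M] [Module (CategoryAlgebra K P) M]
    (hM : CoverIndependent K P M) : Module.Projective (CategoryAlgebra K P) M := by
  have := Fintype.ofFinite P
  let : Module K M := Module.restrictScalars K (CategoryAlgebra K P) M
  have : IsScalarTower K (CategoryAlgebra K P) M := IsScalarTower.restrictScalars K _ M
  refine Module.Projective.of_lifting_property'' fun f hf => ?_
  obtain ⟨h, h₁, -, h₃⟩ := hM.exists_section_of_isLowerSet f hf Finset.univ
    (by rw [Finset.coe_univ]; exact isLowerSet_univ)
  exact ⟨linearMapOfCommutes h fun X Y g m => h₃ X Y g (Finset.mem_univ _) m,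
    LinearMap.ext h₁⟩

/-! ### The criterion for finite posets -/

theorem globalDimension_le_one
    (hP : ∀ {a a' b c : P}, c ≤ a → c ≤ a' → a ⋖ b → a' ⋖ b → a = a') :
    globalDimension.{w} (CategoryAlgebra K P) ≤ 1 :=
  globalDimension_le_one_of_projective_submodules fun ι N =>
    have hN : CoverIndependent K P N :=
      (coverIndependent_finsupp hP ι).of_injective N.subtype N.injective_subtype
    hN.projective

theorem one_le_globalDimension_of_lt {a b : P} (hab : a < b) :
    1 ≤ globalDimension.{w} (CategoryAlgebra K P) :=
  one_le_globalDimension (not_projective_quotient_span_of hab)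

/-- The global dimension of the category algebra of a finite poset that is not an antichain is one
if and only if the poset contains no square. -/
theorem globalDimension_eq_one_iff {a b : P} (hab : a < b) :
    globalDimension.{w} (CategoryAlgebra K P) = 1 ↔
      ¬ ∃ x v w y : P, x ≤ v ∧ x ≤ w ∧ v ≤ y ∧ w ≤ y ∧ ¬ v ≤ w ∧ ¬ w ≤ v := by
  constructor
  · rintro h ⟨x, v, w, y, hxv, hxw, hvy, hwy, hvw, hwv⟩
    exact not_projective_span_of_square hxv hxw hvy hwy hvw hwv
      (projective_submodule_of_globalDimension_le_one h.le _)
  · intro h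
    refine le_antisymm (globalDimension_le_one ?_) (one_le_globalDimension_of_lt hab)
    intro a a' b c hca hca' hab ha'b
    by_contra hne
    -- Distinct elements covered by `b` are incomparable, so a common lower bound `c` completes a
    -- square.
    refine h ⟨c, a, a', b, hca, hca', hab.le, ha'b.le, fun hle => ?_, fun hle => ?_⟩
    · exact hab.2 (lt_of_le_of_ne hle hne) ha'b.lt
    · exact ha'b.2 (lt_of_le_of_ne hle (Ne.symm hne)) hab.lt

end CategoryAlgebra

/-! ### The directed square -/

/-- The last edge of such a path would start at `x`, and no edge enters `x`. -/
theorem SquareVertex.isEmpty_path_v_w : IsEmpty (Quiver.Path SquareVertex.v₁ SquareVertex.w₁) := by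
  refine ⟨fun p => ?_⟩
  cases p with
  | cons p e =>
    change SquareEdge _ _ at e
    cases e
    cases p with
    | cons p e =>
      change SquareEdge _ _ at e
      cases e

theorem SquareVertex.isEmpty_path_w_v : IsEmpty (Quiver.Path SquareVertex.w₁ SquareVertex.v₁) := by
  refine ⟨fun p => ?_⟩
  cases p with
  | cons p e =>
    change SquareEdge _ _ at e
    cases e
    cases p with
    | cons p e =>
      change SquareEdge _ _ at e
      cases e

/-- A poset contains the poset of the directed square if and only if two incomparable elements
have a common lower bound and a common upper bound. -/
theorem nonempty_squarePoset_orderEmbedding_iff {P : Type*} [PartialOrder P] :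
    Nonempty (SquarePoset ↪o P) ↔
      ∃ x v w y : P, x ≤ v ∧ x ≤ w ∧ v ≤ y ∧ w ≤ y ∧ ¬ v ≤ w ∧ ¬ w ≤ v := by
  let c (a : SquareVertex) : SquarePoset := toAntisymmetrization (α := Reach SquareVertex) (· ≤ ·) a
  have hc (a b : SquareVertex) : c a ≤ c b ↔ Nonempty (Quiver.Path a b) := Iff.rfl
  have edge {a b : SquareVertex} (e : a ⟶ b) : c a ≤ c b := ⟨Quiver.Hom.toPath e⟩
  constructor
  · rintro ⟨f⟩
    refine ⟨f (c .x), f (c .v₁), f (c .w₁), f (c .y), f.le_iff_le.2 (edge .xv),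
      f.le_iff_le.2 (edge .xw), f.le_iff_le.2 (edge .vy), f.le_iff_le.2 (edge .wy), ?_, ?_⟩
    · rw [f.le_iff_le, hc, not_nonempty_iff]
      exact SquareVertex.isEmpty_path_v_w
    · rw [f.le_iff_le, hc, not_nonempty_iff]
      exact SquareVertex.isEmpty_path_w_v
  · rintro ⟨x, v, w, y, hxv, hxw, hvy, hwy, hvw, hwv⟩
    let g : SquareVertex → P
      | .x => x
      | .v₁ => v
      | .w₁ => w
      | .y => y
    have hg_edge {a b : SquareVertex} (e : a ⟶ b) : g a ≤ g b := by
      change SquareEdge _ _ at e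
      cases e <;> assumption
    have hg {a b : SquareVertex} : g a ≤ g b ↔ c a ≤ c b := by
      constructor
      · have hxy := (edge .xv).trans (edge .vy)
        -- Weak inequalities suffice: incomparability of `v` and `w` already excludes every relation
        -- absent from the square.
        have h₁ : ¬ v ≤ x := fun h => hvw (h.trans hxw)
        have h₂ : ¬ w ≤ x := fun h => hwv (h.trans hxv)
        have h₃ : ¬ y ≤ v := fun h => hwv (hwy.trans h)
        have h₄ : ¬ y ≤ w := fun h => hvw (hvy.trans h)
        have h₅ : ¬ y ≤ x := fun h => h₁ (hvy.trans h)
        intro h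
        cases a <;> cases b <;>
          first
          | exact le_rfl
          | exact hxy
          | exact edge .xv
          | exact edge .xw
          | exact edge .vy
          | exact edge .wy
          | exact absurd h ‹_›
      · rintro ⟨p⟩
        induction p with
        | nil => exact le_rfl
        | cons p e ih => exact ih.trans (hg_edge e)
    let G : SquarePoset → P := Quotient.lift g fun a b hab =>
      le_antisymm (hg.2 hab.1) (hg.2 hab.2)
    refine ⟨OrderEmbedding.ofMapLEIff G fun a b => ?_⟩
    induction a using Quotient.inductionOn
    induction b using Quotient.inductionOn
    exact hg

theorem mainTheorem7 (K : Type k) [Field K] (V : Type v) [Quiver.{e} V]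
    [Finite V] [∀ a b : V, Finite (a ⟶ b)]
    (hQ : ∃ a b : V, Nonempty (a ⟶ b) ∧ IsEmpty (Quiver.Path b a)) :
    globalDimension.{r} (CategoryAlgebra K (Reach V)) =
        globalDimension.{r} (CategoryAlgebra K (ReachPoset V)) ∧
      (globalDimension.{r} (CategoryAlgebra K (ReachPoset V)) = 1 ↔
        ¬ Nonempty (SquarePoset ↪o ReachPoset V)) := by
  refine ⟨globalDimension_categoryAlgebra_eq_of_equivalence K
    (antisymmetrizationEquivalence (Reach V)), ?_⟩
  obtain ⟨a, b, ⟨f⟩, hba⟩ := hQ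
  -- An edge without a return path becomes a strict relation, which supplies the lower bound 1.
  have hab : toAntisymmetrization (α := Reach V) (· ≤ ·) a <
      toAntisymmetrization (α := Reach V) (· ≤ ·) b :=
    toAntisymmetrization_lt_toAntisymmetrization_iff.2
      (lt_of_le_not_ge ⟨Quiver.Hom.toPath f⟩ (not_nonempty_iff.2 hba))
  rw [nonempty_squarePoset_orderEmbedding_iff]
  exact CategoryAlgebra.globalDimension_eq_one_iff hab
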